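/- For integers $m_1, m_0, n \ge 0$, let $sp(m_1, m_0, n)$ denote the number of partitions of $n$ into positive parts such that the parts are pairwise at least three apart, any two multiples of $3$ among the parts are at least six apart, exactly $m_1$ of the parts are odd, and exactly $m_0$ of the parts are even. Write $(x; t)_n = \prod_{j=1}^{n} (1 - x t^{j-1})$. Then, as formal power series in $a$, $b$, $q$, $$\sum_{m_1, m_0, n \ge 0} sp(m_1, m_0, n)\, a^{m_1} b^{m_0} q^n = \sum_{n_{11}, n_{10}, n_{21}, n_{22} \ge 0} \frac{q^{6 n_{21}^2 - n_{21} + 6 n_{22}^2 + n_{22} + 2 n_{11}^2 - n_{11} + 2 n_{10}^2 + 12 n_{21} n_{22} + 6 (n_{21} + n_{22})(n_{11} + n_{10}) + 4 n_{11} n_{10}}\; a^{n_{21} + n_{22} + n_{11}}\, b^{n_{21} + n_{22} + n_{10}}}{(q^2; q^2)_{n_{11}}\, (q^2; q^2)_{n_{10}}\, (q^6; q^6)_{n_{21}}\, (q^6; q^6)_{n_{22}}}.$$ -/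

import Mathlib

open scoped MvPowerSeries.WithPiTopology

/-- The `q`-Pochhammer symbol `(x; t)_n = (1 - x) (1 - x t) ⋯ (1 - x t ^ (n - 1))`. -/
def qPochhammer {R : Type*} [CommRing R] (x t : R) (n : ℕ) : R :=
  ∏ j ∈ Finset.range n, (1 - x * t ^ j)

/-- Schur's condition on the parts of a partition: the parts are pairwise at least three apart
(in particular they are distinct), and multiples of three are pairwise at least six apart. -/
def SchurCondition (s : Multiset ℕ) : Prop :=
  s.Nodup ∧ ∀ x ∈ s, ∀ y ∈ s, x < y → x + 3 ≤ y ∧ (3 ∣ x ∧ 3 ∣ y → x + 6 ≤ y)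

instance SchurCondition.decidablePred : DecidablePred SchurCondition := fun s => by
  unfold SchurCondition
  infer_instance

/-- The number `sp(m₁, m₀, n)` of partitions of `n` (into positive parts) that satisfy Schur's
condition and have exactly `m₁` odd parts and exactly `m₀` even parts, hence `m₁ + m₀` parts. -/
def sp (m₁ m₀ n : ℕ) : ℕ :=
  (Finset.univ.filter fun p : n.Partition =>
    SchurCondition p.parts ∧
      (p.parts.filter fun k => Odd k).card = m₁ ∧
      (p.parts.filter fun k => Even k).card = m₀).card

namespace SchurParity

/-- Formal power series over `ℤ` in the three variables `a`, `b`, `q`. -/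
abbrev Series : Type := MvPowerSeries (Fin 3) ℤ

/-- The variable `a`, which marks odd parts. -/
noncomputable def a : Series := MvPowerSeries.X 0

/-- The variable `b`, which marks even parts. -/
noncomputable def b : Series := MvPowerSeries.X 1

/-- The variable `q`, which marks the weight. -/
noncomputable def q : Series := MvPowerSeries.X 2

/-- The generating function `∑ sp(m₁, m₀, n) a ^ m₁ b ^ m₀ q ^ n`, that is, the formal power
series in which the coefficient of `a ^ m₁ b ^ m₀ q ^ n` is `sp(m₁, m₀, n)`. -/
def genFun : Series := fun d => (sp (d 0) (d 1) (d 2) : ℤ)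

/-- The reciprocal `1 / (q ^ k; q ^ k)_n` as a formal power series. For `k ≥ 1` the constant
coefficient of `(q ^ k; q ^ k)_n` is the unit `1`, so that this is its multiplicative inverse. -/
noncomputable def invPoch (k n : ℕ) : Series :=
  MvPowerSeries.invOfUnit (qPochhammer (q ^ k) (q ^ k) n) 1

theorem qPochhammer_mul_invPoch {k : ℕ} (hk : k ≠ 0) (n : ℕ) :
    qPochhammer (q ^ k) (q ^ k) n * invPoch k n = 1 := by
  refine MvPowerSeries.mul_invOfUnit _ _ ?_
  simp [qPochhammer, q, hk]

end SchurParity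

namespace SchurParity

/-! ### The series side -/

/-! Let F_k be the generating function of Schur partitions with all parts at least k. Deciding
whether k is a part gives F_k = F_{k+1} + w_k F_{k'}, where w_k is a q^k or b q^k and k' is
`nextPart k`. Modulo q^k, F_k is 1. These facts determine the family (`coeff_eq_of_rec`).

The quadruple series is embedded in the family `quadSeries i j k l`, whose extra linear exponents
supply the same recurrence. Heuristically, n₁₁ and n₁₀ count single odd and even parts, while n₂₁
and n₂₂ count close pairs (m, m + 3) with m ≡ 1 and m ≡ 2 mod 3. The shifts in `tailSeries k` make i
+ 1, j + 2, k + 5, l + 5 the least weight of each such object with parts at least k. Four contiguous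
relations, one per index, then give `tailSeries_rec`, and k = 1 is the theorem. -/

theorem qPochhammer_succ {R : Type*} [CommRing R] (x t : R) (n : ℕ) :
    qPochhammer x t (n + 1) = qPochhammer x t n * (1 - x * t ^ n) :=
  Finset.prod_range_succ _ _

theorem invPoch_zero (k : ℕ) : invPoch k 0 = 1 := by
  have h : (1 : Series) * MvPowerSeries.invOfUnit 1 1 = 1 :=
    MvPowerSeries.mul_invOfUnit _ _ (by simp)
  simpa [invPoch, qPochhammer] using h

theorem invPoch_succ_mul {k : ℕ} (hk : k ≠ 0) (n : ℕ) :
    invPoch k (n + 1) * (1 - q ^ (k * (n + 1))) = invPoch k n := by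
  have h₁ := qPochhammer_mul_invPoch hk n
  have h₂ := qPochhammer_mul_invPoch hk (n + 1)
  rw [qPochhammer_succ] at h₂
  have h₃ : q ^ (k * (n + 1)) = q ^ k * (q ^ k) ^ n := by ring
  rw [h₃]
  linear_combination invPoch k n * h₂
    - invPoch k (n + 1) * (1 - q ^ k * (q ^ k) ^ n) * h₁

/-- The exponent of `q` in `term`, for the indices `(n₁₁, n₁₀, n₂₁, n₂₂) = (x, y, u, v)`. -/
def qExp (i j k l x y u v : ℕ) : ℕ :=
  (2 * x ^ 2 - x) + 2 * y ^ 2 + (6 * u ^ 2 - u) + (6 * v ^ 2 - v)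
    + 12 * u * v + 6 * (u + v) * (x + y) + 4 * x * y + i * x + j * y + k * u + l * v

theorem cast_qExp (i j k l x y u v : ℕ) :
    (qExp i j k l x y u v : ℤ) = (2 * x ^ 2 - x) + 2 * y ^ 2 + (6 * u ^ 2 - u) + (6 * v ^ 2 - v)
      + 12 * u * v + 6 * (u + v) * (x + y) + 4 * x * y + i * x + j * y + k * u + l * v := by
  have h₁ : x ≤ 2 * x ^ 2 := by nlinarith [Nat.le_self_pow two_ne_zero x]
  have h₂ : u ≤ 6 * u ^ 2 := by nlinarith [Nat.le_self_pow two_ne_zero u]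
  have h₃ : v ≤ 6 * v ^ 2 := by nlinarith [Nat.le_self_pow two_ne_zero v]
  unfold qExp
  push_cast [Nat.cast_sub h₁, Nat.cast_sub h₂, Nat.cast_sub h₃]
  ring

/-- The summand of the quadruple series, with additional linear terms in the exponent of `q`. -/
noncomputable def term (i j k l : ℕ) : ℕ × ℕ × ℕ × ℕ → Series := fun n =>
  q ^ qExp i j k l n.1 n.2.1 n.2.2.1 n.2.2.2
    * a ^ (n.2.2.1 + n.2.2.2 + n.1) * b ^ (n.2.2.1 + n.2.2.2 + n.2.1)
    * (invPoch 2 n.1 * invPoch 2 n.2.1 * invPoch 6 n.2.2.1 * invPoch 6 n.2.2.2)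

/-- The quadruple series with additional linear terms in the exponent of `q`. -/
noncomputable def quadSeries (i j k l : ℕ) : Series := ∑' n, term i j k l n

theorem term_eq_monomial_mul (i j k l x y u v : ℕ) :
    term i j k l (x, y, u, v) =
      MvPowerSeries.monomial (Finsupp.single 2 (qExp i j k l x y u v)
        + Finsupp.single 0 (u + v + x) + Finsupp.single 1 (u + v + y)) (1 : ℤ)
        * (invPoch 2 x * invPoch 2 y * invPoch 6 u * invPoch 6 v) := by
  simp only [term, q, a, b, MvPowerSeries.X_pow_eq, MvPowerSeries.monomial_mul_monomial, mul_one]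

theorem le_of_coeff_term_ne_zero {i j k l x y u v : ℕ} {d : Fin 3 →₀ ℕ}
    (h : MvPowerSeries.coeff d (term i j k l (x, y, u, v)) ≠ 0) :
    u + v + x ≤ d 0 ∧ u + v + y ≤ d 1 ∧ qExp i j k l x y u v ≤ d 2 := by
  rw [term_eq_monomial_mul, MvPowerSeries.coeff_monomial_mul] at h
  split_ifs at h with hd
  · have h₀ := hd 0
    have h₁ := hd 1
    have h₂ := hd 2
    simp at h₀ h₁ h₂
    exact ⟨h₀, h₁, h₂⟩
  · exact absurd rfl h

theorem summable_term (i j k l : ℕ) : Summable (term i j k l) := by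
  refine Pi.summable.2 fun d => summable_of_hasFiniteSupport ?_
  refine (((Set.finite_Iic (d 0)).prod ((Set.finite_Iic (d 1)).prod
    ((Set.finite_Iic (d 0)).prod (Set.finite_Iic (d 0)))))).subset ?_
  rintro ⟨x, y, u, v⟩ h
  have := le_of_coeff_term_ne_zero (d := d) h
  simp only [Set.mem_prod, Set.mem_Iic]
  omega

theorem hasSum_term (i j k l : ℕ) : HasSum (term i j k l) (quadSeries i j k l) :=
  (summable_term i j k l).hasSum

/-- The common frame of the four contiguous relations: `e` raises one summation index by one, so
outside its range that index is 0. -/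
theorem tsum_eq_add_mul_of_injective {ι : Type*} {f g h : ι → Series} {F G H : Series}
    (hf : HasSum f F) (hg : HasSum g G) (hh : HasSum h H) {e : ι → ι} (he : e.Injective)
    (c : Series) (h₀ : ∀ n ∉ Set.range e, f n = g n) (h₁ : ∀ n, f (e n) = g (e n) + c * h n) :
    F = G + c * H := by
  have h₂ : HasSum (fun n => f n - g n) (c * H) := by
    refine (he.hasSum_iff fun n hn => sub_eq_zero.2 (h₀ n hn)).1 ?_
    have h₃ : (fun n => f n - g n) ∘ e = fun n => c * h n := funext fun n => by simp [h₁]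
    rw [h₃]
    exact hh.mul_left c
  rw [← (hf.sub hg).unique h₂]
  ring

/-- Raising `i` by 2 multiplies a summand by q^(2x). The difference has the factor 1 - q^(2x), which
vanishes at x = 0 and otherwise cancels the last factor of (q²; q²)_x. Replacing x by x + 1 then
adds (i + 1) + 4x + 4y + 6u + 6v to the exponent. The other three relations arise in the same way.
-/
theorem quadSeries_fst (i j k l : ℕ) :
    quadSeries i j k l = quadSeries (i + 2) j k l
      + a * q ^ (i + 1) * quadSeries (i + 4) (j + 4) (k + 6) (l + 6) := by
  refine tsum_eq_add_mul_of_injective (hasSum_term _ _ _ _) (hasSum_term _ _ _ _)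
    (hasSum_term _ _ _ _) (e := fun n => (n.1 + 1, n.2)) ?_ _ ?_ ?_
  · rintro ⟨x, y, u, v⟩ ⟨x', y', u', v'⟩ h
    simpa using h
  · rintro ⟨_ | x, y, u, v⟩ h
    · simp [term, qExp]
    · exact absurd ⟨(x, y, u, v), rfl⟩ h
  · rintro ⟨x, y, u, v⟩
    have h₁ : qExp (i + 2) j k l (x + 1) y u v = qExp i j k l (x + 1) y u v + 2 * (x + 1) := by
      zify; simp only [cast_qExp]; push_cast; ring
    have h₂ : qExp i j k l (x + 1) y u v
        = qExp (i + 4) (j + 4) (k + 6) (l + 6) x y u v + (i + 1) := by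
      zify; simp only [cast_qExp]; push_cast; ring
    simp only [term, h₁]
    rw [h₂, ← invPoch_succ_mul two_ne_zero x]
    ring

theorem quadSeries_snd (i j k l : ℕ) :
    quadSeries i j k l = quadSeries i (j + 2) k l
      + b * q ^ (j + 2) * quadSeries (i + 4) (j + 4) (k + 6) (l + 6) := by
  refine tsum_eq_add_mul_of_injective (hasSum_term _ _ _ _) (hasSum_term _ _ _ _)
    (hasSum_term _ _ _ _) (e := fun n => (n.1, n.2.1 + 1, n.2.2)) ?_ _ ?_ ?_
  · rintro ⟨x, y, u, v⟩ ⟨x', y', u', v'⟩ h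
    simpa using h
  · rintro ⟨x, _ | y, u, v⟩ h
    · simp [term, qExp]
    · exact absurd ⟨(x, y, u, v), rfl⟩ h
  · rintro ⟨x, y, u, v⟩
    have h₁ : qExp i (j + 2) k l x (y + 1) u v = qExp i j k l x (y + 1) u v + 2 * (y + 1) := by
      zify; simp only [cast_qExp]; push_cast; ring
    have h₂ : qExp i j k l x (y + 1) u v
        = qExp (i + 4) (j + 4) (k + 6) (l + 6) x y u v + (j + 2) := by
      zify; simp only [cast_qExp]; push_cast; ring
    simp only [term, h₁]
    rw [h₂, ← invPoch_succ_mul two_ne_zero y]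
    ring

theorem quadSeries_thd (i j k l : ℕ) :
    quadSeries i j k l = quadSeries i j (k + 6) l
      + a * b * q ^ (k + 5) * quadSeries (i + 6) (j + 6) (k + 12) (l + 12) := by
  refine tsum_eq_add_mul_of_injective (hasSum_term _ _ _ _) (hasSum_term _ _ _ _)
    (hasSum_term _ _ _ _) (e := fun n => (n.1, n.2.1, n.2.2.1 + 1, n.2.2.2)) ?_ _ ?_ ?_
  · rintro ⟨x, y, u, v⟩ ⟨x', y', u', v'⟩ h
    simpa using h
  · rintro ⟨x, y, _ | u, v⟩ h
    · simp [term, qExp]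
    · exact absurd ⟨(x, y, u, v), rfl⟩ h
  · rintro ⟨x, y, u, v⟩
    have h₁ : qExp i j (k + 6) l x y (u + 1) v = qExp i j k l x y (u + 1) v + 6 * (u + 1) := by
      zify; simp only [cast_qExp]; push_cast; ring
    have h₂ : qExp i j k l x y (u + 1) v
        = qExp (i + 6) (j + 6) (k + 12) (l + 12) x y u v + (k + 5) := by
      zify; simp only [cast_qExp]; push_cast; ring
    simp only [term, h₁]
    rw [h₂, ← invPoch_succ_mul (k := 6) (by norm_num) u]
    ring

theorem quadSeries_fth (i j k l : ℕ) :
    quadSeries i j k l = quadSeries i j k (l + 6)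
      + a * b * q ^ (l + 5) * quadSeries (i + 6) (j + 6) (k + 12) (l + 12) := by
  refine tsum_eq_add_mul_of_injective (hasSum_term _ _ _ _) (hasSum_term _ _ _ _)
    (hasSum_term _ _ _ _) (e := fun n => (n.1, n.2.1, n.2.2.1, n.2.2.2 + 1)) ?_ _ ?_ ?_
  · rintro ⟨x, y, u, v⟩ ⟨x', y', u', v'⟩ h
    simpa using h
  · rintro ⟨x, y, u, _ | v⟩ h
    · simp [term, qExp]
    · exact absurd ⟨(x, y, u, v), rfl⟩ h
  · rintro ⟨x, y, u, v⟩
    have h₁ : qExp i j k (l + 6) x y u (v + 1) = qExp i j k l x y u (v + 1) + 6 * (v + 1) := by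
      zify; simp only [cast_qExp]; push_cast; ring
    have h₂ : qExp i j k l x y u (v + 1)
        = qExp (i + 6) (j + 6) (k + 12) (l + 12) x y u v + (l + 5) := by
      zify; simp only [cast_qExp]; push_cast; ring
    simp only [term, h₁]
    rw [h₂, ← invPoch_succ_mul (k := 6) (by norm_num) v]
    ring

/-- The exponent vector that the part `x` contributes. -/
noncomputable def partWeight (x : ℕ) : Fin 3 →₀ ℕ :=
  Finsupp.single (if Odd x then 0 else 1) 1 + Finsupp.single 2 x

theorem monomial_partWeight_of_odd {x : ℕ} (hx : Odd x) :
    MvPowerSeries.monomial (partWeight x) (1 : ℤ) = a * q ^ x := by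
  rw [partWeight, if_pos hx, a, q, MvPowerSeries.X_pow_eq, MvPowerSeries.X,
    MvPowerSeries.monomial_mul_monomial, mul_one]

theorem monomial_partWeight_of_even {x : ℕ} (hx : Even x) :
    MvPowerSeries.monomial (partWeight x) (1 : ℤ) = b * q ^ x := by
  rw [partWeight, if_neg (Nat.not_odd_iff_even.2 hx), b, q, MvPowerSeries.X_pow_eq,
    MvPowerSeries.X, MvPowerSeries.monomial_mul_monomial, mul_one]

/-- The least part that may follow the part `k`, given that the next part is larger than `k`:
after a multiple of three, `k + 3` is also excluded. -/
def nextPart (k : ℕ) : ℕ := if 3 ∣ k then k + 4 else k + 3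

/-- The quadruple series for the partitions into parts at least `k`. -/
noncomputable def tailSeries (k : ℕ) : Series :=
  quadSeries (2 * (k / 2)) (2 * ((k - 1) / 2)) (6 * ((k + 1) / 3)) (6 * (k / 3) + 2)

theorem tailSeries_eq {k i j u v : ℕ} (hi : 2 * (k / 2) = i) (hj : 2 * ((k - 1) / 2) = j)
    (hu : 6 * ((k + 1) / 3) = u) (hv : 6 * (k / 3) + 2 = v) :
    tailSeries k = quadSeries i j u v := by
  subst hi hj hu hv; rfl

/-- If 3 ∣ k, this is a single contiguous relation. Otherwise passing to k + 1 also moves a pair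
index, and the relation for it yields an extra term a b q^(2k+3) Q, the weight of the pair (k, k +
3). Relating the series for parts at least k + 3 to its shift by the part k + 3 yields the same
term, and the two cancel. -/
theorem tailSeries_rec {k : ℕ} (hk : k ≠ 0) :
    tailSeries k = tailSeries (k + 1)
      + MvPowerSeries.monomial (partWeight k) (1 : ℤ) * tailSeries (nextPart k) := by
  -- The residue mod 6 fixes the parity of k and all the floors in `tailSeries`.
  obtain ⟨s, hs⟩ : ∃ s, k = 6 * s + 1 ∨ k = 6 * s + 2 ∨ k = 6 * s + 3 ∨ k = 6 * s + 4
      ∨ k = 6 * s + 5 ∨ k = 6 * s + 6 := ⟨(k - 1) / 6, by omega⟩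
  have hstep : nextPart k = if k % 3 = 0 then k + 4 else k + 3 := by
    simp only [nextPart, Nat.dvd_iff_mod_eq_zero]
  rcases hs with rfl | rfl | rfl | rfl | rfl | rfl
  · rw [monomial_partWeight_of_odd (by grind), hstep, if_neg (by omega),
      tailSeries_eq (i := 6 * s) (j := 6 * s) (u := 12 * s) (v := 12 * s + 2)
        (by omega) (by omega) (by omega) (by omega),
      tailSeries_eq (i := 6 * s + 2) (j := 6 * s) (u := 12 * s + 6) (v := 12 * s + 2)
        (by omega) (by omega) (by omega) (by omega),
      tailSeries_eq (i := 6 * s + 4) (j := 6 * s + 2) (u := 12 * s + 6) (v := 12 * s + 8)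
        (by omega) (by omega) (by omega) (by omega)]
    have h₁ := quadSeries_fst (6 * s) (6 * s) (12 * s) (12 * s + 2)
    have h₂ := quadSeries_snd (6 * s + 4) (6 * s + 2) (12 * s + 6) (12 * s + 8)
    have h₃ := quadSeries_thd (6 * s + 2) (6 * s) (12 * s) (12 * s + 2)
    simp only [add_assoc, Nat.reduceAdd] at h₁ h₂ h₃ ⊢
    linear_combination h₁ - a * q ^ (6 * s + 1) * h₂ + h₃
  · rw [monomial_partWeight_of_even (by grind), hstep, if_neg (by omega),
      tailSeries_eq (i := 6 * s + 2) (j := 6 * s) (u := 12 * s + 6) (v := 12 * s + 2)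
        (by omega) (by omega) (by omega) (by omega),
      tailSeries_eq (i := 6 * s + 2) (j := 6 * s + 2) (u := 12 * s + 6) (v := 12 * s + 8)
        (by omega) (by omega) (by omega) (by omega),
      tailSeries_eq (i := 6 * s + 4) (j := 6 * s + 4) (u := 12 * s + 12) (v := 12 * s + 8)
        (by omega) (by omega) (by omega) (by omega)]
    have h₁ := quadSeries_snd (6 * s + 2) (6 * s) (12 * s + 6) (12 * s + 2)
    have h₂ := quadSeries_fst (6 * s + 4) (6 * s + 4) (12 * s + 12) (12 * s + 8)
    have h₃ := quadSeries_fth (6 * s + 2) (6 * s + 2) (12 * s + 6) (12 * s + 2)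
    simp only [add_assoc, Nat.reduceAdd] at h₁ h₂ h₃ ⊢
    linear_combination h₁ - b * q ^ (6 * s + 2) * h₂ + h₃
  · rw [monomial_partWeight_of_odd (by grind), hstep, if_pos (by omega),
      tailSeries_eq (i := 6 * s + 2) (j := 6 * s + 2) (u := 12 * s + 6) (v := 12 * s + 8)
        (by omega) (by omega) (by omega) (by omega),
      tailSeries_eq (i := 6 * s + 4) (j := 6 * s + 2) (u := 12 * s + 6) (v := 12 * s + 8)
        (by omega) (by omega) (by omega) (by omega),
      tailSeries_eq (i := 6 * s + 6) (j := 6 * s + 6) (u := 12 * s + 12) (v := 12 * s + 14)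
        (by omega) (by omega) (by omega) (by omega)]
    exact quadSeries_fst (6 * s + 2) (6 * s + 2) (12 * s + 6) (12 * s + 8)
  · rw [monomial_partWeight_of_even (by grind), hstep, if_neg (by omega),
      tailSeries_eq (i := 6 * s + 4) (j := 6 * s + 2) (u := 12 * s + 6) (v := 12 * s + 8)
        (by omega) (by omega) (by omega) (by omega),
      tailSeries_eq (i := 6 * s + 4) (j := 6 * s + 4) (u := 12 * s + 12) (v := 12 * s + 8)
        (by omega) (by omega) (by omega) (by omega),
      tailSeries_eq (i := 6 * s + 6) (j := 6 * s + 6) (u := 12 * s + 12) (v := 12 * s + 14)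
        (by omega) (by omega) (by omega) (by omega)]
    have h₁ := quadSeries_snd (6 * s + 4) (6 * s + 2) (12 * s + 6) (12 * s + 8)
    have h₂ := quadSeries_fst (6 * s + 6) (6 * s + 6) (12 * s + 12) (12 * s + 14)
    have h₃ := quadSeries_thd (6 * s + 4) (6 * s + 4) (12 * s + 6) (12 * s + 8)
    simp only [add_assoc, Nat.reduceAdd] at h₁ h₂ h₃ ⊢
    linear_combination h₁ - b * q ^ (6 * s + 4) * h₂ + h₃
  · rw [monomial_partWeight_of_odd (by grind), hstep, if_neg (by omega),
      tailSeries_eq (i := 6 * s + 4) (j := 6 * s + 4) (u := 12 * s + 12) (v := 12 * s + 8)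
        (by omega) (by omega) (by omega) (by omega),
      tailSeries_eq (i := 6 * s + 6) (j := 6 * s + 4) (u := 12 * s + 12) (v := 12 * s + 14)
        (by omega) (by omega) (by omega) (by omega),
      tailSeries_eq (i := 6 * s + 8) (j := 6 * s + 6) (u := 12 * s + 18) (v := 12 * s + 14)
        (by omega) (by omega) (by omega) (by omega)]
    have h₁ := quadSeries_fst (6 * s + 4) (6 * s + 4) (12 * s + 12) (12 * s + 8)
    have h₂ := quadSeries_snd (6 * s + 8) (6 * s + 6) (12 * s + 18) (12 * s + 14)
    have h₃ := quadSeries_fth (6 * s + 6) (6 * s + 4) (12 * s + 12) (12 * s + 8)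
    simp only [add_assoc, Nat.reduceAdd] at h₁ h₂ h₃ ⊢
    linear_combination h₁ - a * q ^ (6 * s + 5) * h₂ + h₃
  · rw [monomial_partWeight_of_even (by grind), hstep, if_pos (by omega),
      tailSeries_eq (i := 6 * s + 6) (j := 6 * s + 4) (u := 12 * s + 12) (v := 12 * s + 14)
        (by omega) (by omega) (by omega) (by omega),
      tailSeries_eq (i := 6 * s + 6) (j := 6 * s + 6) (u := 12 * s + 12) (v := 12 * s + 14)
        (by omega) (by omega) (by omega) (by omega),
      tailSeries_eq (i := 6 * s + 10) (j := 6 * s + 8) (u := 12 * s + 18) (v := 12 * s + 20)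
        (by omega) (by omega) (by omega) (by omega)]
    exact quadSeries_snd (6 * s + 6) (6 * s + 4) (12 * s + 12) (12 * s + 14)

/-- The bounds i + 1, j + 2, k + 5, l + 5 are the exponents at the four unit vectors, and the
exponent grows at least linearly from there. -/
theorem le_qExp {c i j k l x y u v : ℕ} (hi : c ≤ i + 1) (hj : c ≤ j + 2) (hk : c ≤ k + 5)
    (hl : c ≤ l + 5) (h : (x, y, u, v) ≠ (0, 0, 0, 0)) : c ≤ qExp i j k l x y u v := by
  have hx : i * x + x ≤ (2 * x ^ 2 - x) + i * x := by
    have : x ≤ x ^ 2 := Nat.le_self_pow two_ne_zero x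
    omega
  have hy : j * y + 2 * y ≤ 2 * y ^ 2 + j * y := by
    have : y ≤ y ^ 2 := Nat.le_self_pow two_ne_zero y
    omega
  have hu : k * u + 5 * u ≤ (6 * u ^ 2 - u) + k * u := by
    have : u ≤ u ^ 2 := Nat.le_self_pow two_ne_zero u
    omega
  have hv : l * v + 5 * v ≤ (6 * v ^ 2 - v) + l * v := by
    have : v ≤ v ^ 2 := Nat.le_self_pow two_ne_zero v
    omega
  have key : c * (x + y + u + v) ≤ qExp i j k l x y u v := by
    calc c * (x + y + u + v) = c * x + c * y + c * u + c * v := by ring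
      _ ≤ (i + 1) * x + (j + 2) * y + (k + 5) * u + (l + 5) * v := by gcongr
      _ = (i * x + x) + (j * y + 2 * y) + (k * u + 5 * u) + (l * v + 5 * v) := by ring
      _ ≤ qExp i j k l x y u v := by unfold qExp; omega
  have hpos : 1 ≤ x + y + u + v := by
    by_contra hn
    exact h (by simp only [Prod.mk.injEq]; omega)
  exact (Nat.le_mul_of_pos_right c hpos).trans key

theorem coeff_tailSeries_of_lt {k : ℕ} {d : Fin 3 →₀ ℕ} (h : d 2 < k) :
    MvPowerSeries.coeff d (tailSeries k) = if d = 0 then 1 else 0 := by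
  have h₁ := Pi.hasSum.1 (hasSum_term (2 * (k / 2)) (2 * ((k - 1) / 2)) (6 * ((k + 1) / 3))
    (6 * (k / 3) + 2)) d
  have h₂ := hasSum_single (f := fun n => term (2 * (k / 2)) (2 * ((k - 1) / 2))
    (6 * ((k + 1) / 3)) (6 * (k / 3) + 2) n d) (0, 0, 0, 0) (by
      rintro ⟨x, y, u, v⟩ hn
      by_contra h₃
      have h₄ := (le_of_coeff_term_ne_zero (d := d) h₃).2.2
      have := le_qExp (c := k) (by omega) (by omega) (by omega) (by omega) hn |>.trans h₄
      omega)
  refine (h₁.unique h₂).trans ?_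
  have h₅ : term (2 * (k / 2)) (2 * ((k - 1) / 2)) (6 * ((k + 1) / 3)) (6 * (k / 3) + 2)
      (0, 0, 0, 0) = 1 := by
    simp [term, qExp, invPoch_zero]
  rw [h₅]
  exact MvPowerSeries.coeff_one (R := ℤ) d

/-! ### The partition side -/

/-- The exponent vector of a partition: the numbers of odd and even parts, and the sum. -/
noncomputable def weight (s : Multiset ℕ) : Fin 3 →₀ ℕ := (s.map partWeight).sum

theorem weight_cons (x : ℕ) (s : Multiset ℕ) : weight (x ::ₘ s) = partWeight x + weight s := by
  simp [weight]

theorem weight_apply (s : Multiset ℕ) :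
    weight s 0 = (s.filter fun k => Odd k).card ∧
      weight s 1 = (s.filter fun k => Even k).card ∧ weight s 2 = s.sum := by
  induction s using Multiset.induction with
  | empty => simp [weight]
  | cons x s ih =>
    rw [weight_cons]
    simp only [Finsupp.add_apply, ih]
    rcases Nat.even_or_odd x with hx | hx
    · have : ¬ Odd x := Nat.not_odd_iff_even.2 hx
      simp [partWeight, hx, this, add_comm]
    · have : ¬ Even x := Nat.not_even_iff_odd.2 hx
      simp [partWeight, hx, this, add_comm]

/-- The partitions with exponent vector `d` that satisfy Schur's condition and have all parts at
least `k`. -/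
def schurSet (k : ℕ) (d : Fin 3 →₀ ℕ) : Set (Multiset ℕ) :=
  {s | SchurCondition s ∧ (∀ x ∈ s, k ≤ x) ∧ weight s = d}

theorem finite_schurSet {k : ℕ} (hk : k ≠ 0) (d : Fin 3 →₀ ℕ) : (schurSet k d).Finite := by
  refine (Set.finite_range fun p : (d 2).Partition => p.parts).subset ?_
  rintro s ⟨-, h₁, rfl⟩
  exact ⟨⟨s, fun {x} hx => (Nat.pos_of_ne_zero hk).trans_le (h₁ x hx),
    (weight_apply s).2.2.symm⟩, rfl⟩

/-- If 3 ∣ k, the only multiple of three in [k + 3, k + 6) is k + 3 itself, so the condition at k is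
a plain lower bound on the other parts. -/
theorem schurCondition_cons {k : ℕ} {s : Multiset ℕ} (h : ∀ x ∈ s, k ≤ x) :
    SchurCondition (k ::ₘ s) ↔ SchurCondition s ∧ ∀ x ∈ s, nextPart k ≤ x := by
  simp only [SchurCondition, Multiset.nodup_cons, Multiset.mem_cons]
  constructor
  · rintro ⟨⟨h₁, h₂⟩, h₃⟩
    refine ⟨⟨h₂, fun x hx y hy => h₃ x (.inr hx) y (.inr hy)⟩, fun x hx => ?_⟩
    have h₄ : k ≠ x := fun e => h₁ (e ▸ hx)
    have h₅ := h x hx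
    have h₆ := h₃ k (.inl rfl) x (.inr hx) (by omega)
    unfold nextPart
    split_ifs <;> omega
  · rintro ⟨⟨h₁, h₂⟩, h₃⟩
    have h₄ : ∀ x ∈ s, k + 3 ≤ x ∧ (3 ∣ k ∧ 3 ∣ x → k + 6 ≤ x) := fun x hx => by
      have := h₃ x hx
      unfold nextPart at this
      split_ifs at this <;> omega
    refine ⟨⟨fun hk => by have := h₄ k hk; omega, h₁⟩, ?_⟩
    rintro x (rfl | hx) y (rfl | hy) hxy
    · omega
    · exact h₄ y hy
    · have := h x hx
      omega
    · exact h₂ x hx y hy hxy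

theorem le_nextPart (k : ℕ) : k + 3 ≤ nextPart k := by
  unfold nextPart
  split_ifs <;> omega

theorem schurSet_eq_union (k : ℕ) (d : Fin 3 →₀ ℕ) :
    schurSet k d = schurSet (k + 1) d ∪
      -- Using `weight s` as the index makes the weight clause trivial and avoids the truncated
      -- difference `d - partWeight k`.
      (k ::ₘ ·) '' {s | s ∈ schurSet (nextPart k) (weight s) ∧ partWeight k + weight s = d} := by
  ext s
  simp only [schurSet, Set.mem_union, Set.mem_ofPred_eq, Set.mem_image, and_true]
  constructor
  · rintro ⟨h₁, h₂, h₃⟩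
    by_cases hk : k ∈ s
    · obtain ⟨t, rfl⟩ := Multiset.exists_cons_of_mem hk
      have h₄ := fun x hx => h₂ x (Multiset.mem_cons_of_mem hx)
      exact .inr ⟨t, ⟨(schurCondition_cons h₄).1 h₁, by rw [← weight_cons, h₃]⟩, rfl⟩
    · refine .inl ⟨h₁, fun x hx => ?_, h₃⟩
      exact Nat.lt_of_le_of_ne (h₂ x hx) fun e => hk (e ▸ hx)
  · rintro (⟨h₁, h₂, h₃⟩ | ⟨t, ⟨h₁, h₂⟩, rfl⟩)
    · exact ⟨h₁, fun x hx => (Nat.le_succ k).trans (h₂ x hx), h₃⟩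
    · have h₄ : ∀ x ∈ t, k ≤ x := fun x hx => by
        have := h₁.2 x hx
        have := le_nextPart k
        omega
      refine ⟨(schurCondition_cons h₄).2 h₁, ?_, by rw [weight_cons, h₂]⟩
      simpa using h₄

/-- The generating function of the partitions into parts at least `k` that satisfy Schur's
condition. -/
noncomputable def tailGenFun (k : ℕ) : Series := fun d => ((schurSet k d).ncard : ℤ)

theorem tailGenFun_rec {k : ℕ} (hk : k ≠ 0) :
    tailGenFun k = tailGenFun (k + 1)
      + MvPowerSeries.monomial (partWeight k) (1 : ℤ) * tailGenFun (nextPart k) := by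
  ext d
  rw [map_add, MvPowerSeries.coeff_monomial_mul]
  change ((schurSet k d).ncard : ℤ) = ((schurSet (k + 1) d).ncard : ℤ)
    + if partWeight k ≤ d then
      1 * ((schurSet (nextPart k) (d - partWeight k)).ncard : ℤ) else 0
  have hfin : (schurSet k d).Finite := finite_schurSet hk d
  have hunion := schurSet_eq_union k d
  rw [hunion] at hfin
  rw [hunion, Set.ncard_union_eq ?_ (hfin.subset Set.subset_union_left)
    (hfin.subset Set.subset_union_right),
    Set.ncard_image_of_injective _ fun s t h => (Multiset.cons_inj_right k).1 h]
  · push_cast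
    congr 1
    split_ifs with h
    · rw [one_mul]
      congr 2
      ext s
      simp only [schurSet, Set.mem_ofPred_eq, and_true, and_assoc, eq_tsub_iff_add_eq_of_le h,
        add_comm]
    · have hempty : {s | s ∈ schurSet (nextPart k) (weight s) ∧ partWeight k + weight s = d} = ∅ :=
        Set.eq_empty_of_forall_notMem fun s hs => h (hs.2 ▸ le_self_add)
      simp [hempty]
  · rw [Set.disjoint_left]
    rintro s hs ⟨t, -, rfl⟩
    have := hs.2.1 k (Multiset.mem_cons_self k t)
    omega

theorem coeff_tailGenFun_of_lt {k : ℕ} {d : Fin 3 →₀ ℕ} (h : d 2 < k) :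
    MvPowerSeries.coeff d (tailGenFun k) = if d = 0 then 1 else 0 := by
  have hempty : ∀ s ∈ schurSet k d, s = 0 := by
    rintro s ⟨-, h₁, rfl⟩
    refine Multiset.eq_zero_of_forall_notMem fun x hx => ?_
    have h₂ := Multiset.single_le_sum (fun _ _ => Nat.zero_le _) x hx
    rw [← (weight_apply s).2.2] at h₂
    have := h₁ x hx
    omega
  change ((schurSet k d).ncard : ℤ) = _
  split_ifs with hd
  · have : schurSet k d = {0} := by
      refine Set.eq_singleton_iff_unique_mem.2 ⟨?_, hempty⟩
      simp [schurSet, SchurCondition, weight, hd]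
    simp [this]
  · have : schurSet k d = ∅ := by
      refine Set.eq_empty_of_forall_notMem fun s hs => hd ?_
      rw [← hs.2.2, hempty s hs]
      simp [weight]
    simp [this]

/-! ### Comparison -/

/-- Each use of the recurrence raises k without raising the q-degree of d, so after finitely many
steps k exceeds that degree and `h` applies. -/
theorem coeff_eq_of_rec {f g : ℕ → Series}
    (hf : ∀ k ≠ 0, f k = f (k + 1)
      + MvPowerSeries.monomial (partWeight k) (1 : ℤ) * f (nextPart k))
    (hg : ∀ k ≠ 0, g k = g (k + 1)
      + MvPowerSeries.monomial (partWeight k) (1 : ℤ) * g (nextPart k))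
    (h : ∀ k d, d 2 < k → MvPowerSeries.coeff d (f k) = MvPowerSeries.coeff d (g k))
    (r k : ℕ) (hk : k ≠ 0) (d : Fin 3 →₀ ℕ) (hr : d 2 < k + r) :
    MvPowerSeries.coeff d (f k) = MvPowerSeries.coeff d (g k) := by
  induction r generalizing k d with
  | zero => exact h k d hr
  | succ r ih =>
    rw [hf k hk, hg k hk, map_add, map_add, MvPowerSeries.coeff_monomial_mul,
      MvPowerSeries.coeff_monomial_mul, ih (k + 1) (by omega) d (by omega)]
    have h₁ := le_nextPart k
    have h₂ : (d - partWeight k) 2 ≤ d 2 := by simp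
    rw [ih (nextPart k) (by omega) (d - partWeight k) (by omega)]

theorem tailSeries_eq_tailGenFun {k : ℕ} (hk : k ≠ 0) : tailSeries k = tailGenFun k := by
  ext d
  refine coeff_eq_of_rec (fun _ => tailSeries_rec) (fun _ => tailGenFun_rec) (fun k d h => ?_)
    (d 2 + 1) k hk d (by omega)
  rw [coeff_tailSeries_of_lt h, coeff_tailGenFun_of_lt h]

theorem tailGenFun_one : tailGenFun 1 = genFun := by
  funext d
  change ((schurSet 1 d).ncard : ℤ) = (sp (d 0) (d 1) (d 2) : ℤ)
  rw [sp, ← Set.ncard_coe_finset, ← Set.ncard_image_of_injective (f := Nat.Partition.parts) _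
    fun p p' h => Nat.Partition.ext h]
  congr 2
  ext s
  obtain ⟨h₀, h₁, h₂⟩ := weight_apply s
  simp only [schurSet, Set.mem_ofPred_eq, Set.mem_image, Finset.coe_filter, Finset.mem_univ,
    true_and]
  constructor
  · rintro ⟨h₃, h₄, rfl⟩
    exact ⟨⟨s, fun {x} hx => h₄ x hx, h₂.symm⟩, ⟨h₃, h₀.symm, h₁.symm⟩, rfl⟩
  · rintro ⟨p, ⟨h₃, h₄, h₅⟩, rfl⟩
    refine ⟨h₃, fun x hx => p.parts_pos hx, ?_⟩
    ext i
    fin_cases i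
    · exact h₀.trans h₄
    · exact h₁.trans h₅
    · exact h₂.trans p.parts_sum

end SchurParity

theorem mainTheorem3 :
    HasSum
      (fun i : ℕ × ℕ × ℕ × ℕ =>
        match i with
        | (n₁₁, n₁₀, n₂₁, n₂₂) =>
          SchurParity.q ^
              ((6 * n₂₁ ^ 2 - n₂₁) + (6 * n₂₂ ^ 2 + n₂₂) + (2 * n₁₁ ^ 2 - n₁₁) + 2 * n₁₀ ^ 2
                + 12 * n₂₁ * n₂₂ + 6 * (n₂₁ + n₂₂) * (n₁₁ + n₁₀) + 4 * n₁₁ * n₁₀)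
            * SchurParity.a ^ (n₂₁ + n₂₂ + n₁₁)
            * SchurParity.b ^ (n₂₁ + n₂₂ + n₁₀)
            * (SchurParity.invPoch 2 n₁₁ * SchurParity.invPoch 2 n₁₀
                * SchurParity.invPoch 6 n₂₁ * SchurParity.invPoch 6 n₂₂))
      SchurParity.genFun := by
  rw [← SchurParity.tailGenFun_one, ← SchurParity.tailSeries_eq_tailGenFun one_ne_zero]
  -- The shift 2 in the last slot turns 6v² - v into the 6v² + v of the statement.
  refine (SchurParity.hasSum_term 0 0 0 2).congr_fun ?_
  rintro ⟨x, y, u, v⟩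
  have h : v ≤ 6 * v ^ 2 := by nlinarith [Nat.le_self_pow two_ne_zero v]
  simp only [SchurParity.term, SchurParity.qExp]
  congr 4
  omega
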